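/- Let $R$ be an integral domain with finite quotients, i.e. $R$ is a commutative unital ring with $1\neq 0$ and without zero-divisors such that $R/(b)$ is finite for every $b\in R$, $b\neq 0$. Put $R^\times=R\setminus\{0\}$. The Cuntz--Li algebra $\mathfrak A[R]$ is the universal (unital) C*-algebra generated by unitaries $u^a$ ($a\in R$) and isometries $s_b$ ($b\in R^\times$) subject to $u^0=1$, $$u^a s_b u^c s_d=u^{a+bc}s_{bd}\quad(a,c\in R;\ b,d\in R^\times),\qquad \sum_{a+(b)\in R/(b)}u^a s_b s_b^* u^{-a}=1\quad(b\in R^\times).$$ Let $\mathcal F$ be any (possibly empty) family of nontrivial, that is nonzero, ideals of $R$. Let $\mathcal C(\mathcal F)$ be the smallest family of subsets of $R$ which contains $\mathcal F$ and $R$, is closed under finite unions, finite intersections and complements, and satisfies $a+b\cdot X\in\mathcal C(\mathcal F)$ for all $X\in\mathcal C(\mathcal F)$, $a\in R$, $b\in R^\times$. The algebra $\mathfrak A_{\mathcal F}[R]$ is the universal (unital) C*-algebra generated by projections $e_X$ ($X\in\mathcal C(\mathcal F)$), unitaries $u^a$ ($a\in R$) and isometries $s_b$ ($b\in R^\times$)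 subject to $u^0=1$, $$u^a s_b u^c s_d=u^{a+bc}s_{bd},\qquad (u^a s_b)\,e_X\,(u^a s_b)^*=e_{a+b\cdot X},$$ $$e_R=1,\qquad e_Xe_Y=e_{X\cap Y},\qquad e_{X\cup Y}=e_X+e_Y\ \text{ if } X\cap Y=\emptyset .$$ Then there is exactly one unital $*$-homomorphism $\mathfrak A[R]\to\mathfrak A_{\mathcal F}[R]$ with $u^a\mapsto u^a$ for all $a\in R$ and $s_b\mapsto s_b$ for all $b\in R^\times$, and it is an isomorphism. -/

import Mathlib

open scoped nonZeroDivisors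

universe u

noncomputable section

/-! ### The free unital complex `*`-algebra on a set of generators -/

/-- The complex algebra `Aᵐᵒᵖ` with conjugated scalar multiplication; a conjugate-linear
anti-homomorphism `A → A` is the same thing as a homomorphism of complex algebras `A → ConjOp A`. -/
def ConjOp (A : Type u) : Type u := Aᵐᵒᵖ

instance (A : Type u) [Ring A] : Ring (ConjOp A) := inferInstanceAs (Ring Aᵐᵒᵖ)

instance (A : Type u) [Ring A] [Algebra ℂ A] : Algebra ℂ (ConjOp A) :=
  RingHom.toAlgebra'
    (((algebraMap ℂ Aᵐᵒᵖ).comp (starRingEnd ℂ) : ℂ →+* Aᵐᵒᵖ) : ℂ →+* ConjOp A)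
    (fun c x => Algebra.commutes (A := Aᵐᵒᵖ) (starRingEnd ℂ c) x)

/-- The free unital complex `*`-algebra on `G`: noncommutative polynomials in the letters
`g` (`Sum.inl g`) and `g*` (`Sum.inr g`), for `g ∈ G`. -/
def FreeStarAlgebra (G : Type u) : Type u := FreeAlgebra ℂ (G ⊕ G)

namespace FreeStarAlgebra

variable {G : Type u}

instance : Ring (FreeStarAlgebra G) := inferInstanceAs (Ring (FreeAlgebra ℂ (G ⊕ G)))

instance : Algebra ℂ (FreeStarAlgebra G) := inferInstanceAs (Algebra ℂ (FreeAlgebra ℂ (G ⊕ G)))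

/-- The generator `g`. -/
def gen (g : G) : FreeStarAlgebra G := FreeAlgebra.ι ℂ (Sum.inl g : G ⊕ G)

/-- The adjoint `g*` of the generator `g`. -/
def genStar (g : G) : FreeStarAlgebra G := FreeAlgebra.ι ℂ (Sum.inr g : G ⊕ G)

/-- The involution as an algebra homomorphism into the conjugate opposite algebra:
it exchanges the letters `g` and `g*`. -/
def starHom : FreeAlgebra ℂ (G ⊕ G) →ₐ[ℂ] ConjOp (FreeStarAlgebra G) :=
  FreeAlgebra.lift ℂ (fun x => (MulOpposite.op (Sum.elim genStar gen x) : (FreeStarAlgebra G)ᵐᵒᵖ))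

/-- The conjugate-linear involution reversing products. -/
def starFun (x : FreeStarAlgebra G) : FreeStarAlgebra G :=
  MulOpposite.unop (starHom x : (FreeStarAlgebra G)ᵐᵒᵖ)

theorem starFun_mul (x y : FreeStarAlgebra G) : starFun (x * y) = starFun y * starFun x := by
  have h : starHom (x * y : FreeAlgebra ℂ (G ⊕ G)) = starHom x * starHom y := map_mul _ _ _
  exact congrArg MulOpposite.unop h

theorem starFun_add (x y : FreeStarAlgebra G) : starFun (x + y) = starFun x + starFun y := by
  have h : starHom (x + y : FreeAlgebra ℂ (G ⊕ G)) = starHom x + starHom y := map_add _ _ _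
  exact congrArg MulOpposite.unop h

theorem starFun_algebraMap (c : ℂ) :
    starFun (algebraMap ℂ (FreeStarAlgebra G) c)
      = algebraMap ℂ (FreeStarAlgebra G) (starRingEnd ℂ c) :=
  congrArg MulOpposite.unop (AlgHom.commutes (starHom (G := G)) c)

theorem starFun_gen (g : G) : starFun (gen g) = genStar g :=
  congrArg MulOpposite.unop (FreeAlgebra.lift_ι_apply (R := ℂ) (A := ConjOp (FreeStarAlgebra G))
    (fun x => (MulOpposite.op (Sum.elim genStar gen x) : (FreeStarAlgebra G)ᵐᵒᵖ)) (Sum.inl g))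

theorem starFun_genStar (g : G) : starFun (genStar g) = gen g :=
  congrArg MulOpposite.unop (FreeAlgebra.lift_ι_apply (R := ℂ) (A := ConjOp (FreeStarAlgebra G))
    (fun x => (MulOpposite.op (Sum.elim genStar gen x) : (FreeStarAlgebra G)ᵐᵒᵖ)) (Sum.inr g))

@[elab_as_elim]
theorem induction {C : FreeStarAlgebra G → Prop} (hc : ∀ c : ℂ, C (algebraMap ℂ _ c))
    (hg : ∀ g, C (gen g)) (hs : ∀ g, C (genStar g))
    (hm : ∀ x y, C x → C y → C (x * y)) (ha : ∀ x y, C x → C y → C (x + y))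
    (x : FreeStarAlgebra G) : C x :=
  FreeAlgebra.induction ℂ (G ⊕ G) hc (fun z => by cases z <;> [exact hg _; exact hs _]) hm ha x

instance : StarRing (FreeStarAlgebra G) where
  star := starFun
  star_involutive x := by
    induction x using induction with
    | hc c => rw [starFun_algebraMap, starFun_algebraMap, Complex.conj_conj]
    | hg g => rw [starFun_gen, starFun_genStar]
    | hs g => rw [starFun_genStar, starFun_gen]
    | hm x y hx hy => rw [starFun_mul, starFun_mul, hx, hy]
    | ha x y hx hy => rw [starFun_add, starFun_add, hx, hy]
  star_mul := starFun_mul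
  star_add := starFun_add

theorem star_gen (g : G) : star (gen g) = genStar g := starFun_gen g

theorem star_genStar (g : G) : star (genStar g) = gen g := starFun_genStar g

theorem star_algebraMap (c : ℂ) :
    star (algebraMap ℂ (FreeStarAlgebra G) c) = algebraMap ℂ (FreeStarAlgebra G) (star c) :=
  starFun_algebraMap c

instance : StarModule ℂ (FreeStarAlgebra G) where
  star_smul c x := by
    rw [Algebra.smul_def, Algebra.smul_def, star_mul, star_algebraMap, Algebra.commutes]

/-- The `*`-homomorphism on the free `*`-algebra given by prescribed images of the generators. -/
def lift {B : Type*} [Ring B] [StarRing B] [Algebra ℂ B] [StarModule ℂ B] (f : G → B) :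
    FreeStarAlgebra G →⋆ₐ[ℂ] B :=
  let φ : FreeStarAlgebra G →ₐ[ℂ] B :=
    FreeAlgebra.lift ℂ (Sum.elim f (fun g => star (f g)))
  have hgen : ∀ g, φ (gen g) = f g := fun _ => FreeAlgebra.lift_ι_apply _ _
  have hgenStar : ∀ g, φ (genStar g) = star (f g) := fun _ => FreeAlgebra.lift_ι_apply _ _
  { φ with
    map_star' := fun x => by
      change φ (star x) = star (φ x)
      induction x using induction with
      | hc c =>
        rw [star_algebraMap, AlgHom.commutes, AlgHom.commutes, algebraMap_star_comm]
      | hg g => rw [star_gen, hgen, hgenStar]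
      | hs g => rw [star_genStar, hgen, hgenStar, star_star]
      | hm x y hx hy => rw [star_mul, map_mul, map_mul, star_mul, hx, hy]
      | ha x y hx hy => rw [star_add, map_add, map_add, star_add, hx, hy] }

theorem lift_gen {B : Type*} [Ring B] [StarRing B] [Algebra ℂ B] [StarModule ℂ B] (f : G → B)
    (g : G) : lift f (gen g) = f g :=
  FreeAlgebra.lift_ι_apply (R := ℂ) (Sum.elim f (fun g => star (f g))) (Sum.inl g)

end FreeStarAlgebra

/-! ### Universal C*-algebras given by generators and relations -/

/-- A C*-seminorm on the free `*`-algebra on `G` for which the relations `r x y`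
(read as `x = y`) hold. -/
structure IsAdmissibleSeminorm {G : Type u}
    (r : FreeStarAlgebra G → FreeStarAlgebra G → Prop) (p : Seminorm ℂ (FreeStarAlgebra G)) :
    Prop where
  mul_le : ∀ x y, p (x * y) ≤ p x * p y
  star_mul_self : ∀ x, p (star x * x) = p x * p x
  rel : ∀ x y, r x y → p (x - y) = 0

/-- Generators and relations such that, for each generator, the norms of its images under all
representations of the relations are bounded. -/
structure CStarPresentation where
  Gen : Type u
  Rel : FreeStarAlgebra Gen → FreeStarAlgebra Gen → Prop
  bounded : ∀ g : Gen, ∃ M : ℝ, ∀ p : Seminorm ℂ (FreeStarAlgebra Gen),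
    IsAdmissibleSeminorm Rel p → p (FreeStarAlgebra.gen g) ≤ M

namespace IsAdmissibleSeminorm

variable {G : Type u} {r : FreeStarAlgebra G → FreeStarAlgebra G → Prop}
  {p : Seminorm ℂ (FreeStarAlgebra G)}

theorem zero (r : FreeStarAlgebra G → FreeStarAlgebra G → Prop) :
    IsAdmissibleSeminorm r (0 : Seminorm ℂ (FreeStarAlgebra G)) where
  mul_le x y := by simp
  star_mul_self x := by simp
  rel x y _ := by simp

theorem le_star (hp : IsAdmissibleSeminorm r p) (x : FreeStarAlgebra G) : p x ≤ p (star x) := by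
  have h1 := hp.star_mul_self x
  have h2 := hp.mul_le (star x) x
  rw [h1] at h2
  rcases (apply_nonneg p x).eq_or_lt with h | h
  · rw [← h]; exact apply_nonneg p _
  · exact le_of_mul_le_mul_right h2 h

theorem star_eq (hp : IsAdmissibleSeminorm r p) (x : FreeStarAlgebra G) : p (star x) = p x :=
  le_antisymm (by simpa using hp.le_star (star x)) (hp.le_star x)

theorem one_le (hp : IsAdmissibleSeminorm r p) : p 1 ≤ 1 := by
  have h := hp.star_mul_self 1
  rw [star_one, one_mul] at h
  nlinarith [apply_nonneg p (1 : FreeStarAlgebra G)]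

theorem eq_of_rel (hp : IsAdmissibleSeminorm r p) {x y : FreeStarAlgebra G} (h : r x y) :
    p x = p y := by
  have h1 := hp.rel x y h
  have h2 := abs_sub_map_le_sub p x y
  rw [h1] at h2
  exact sub_eq_zero.mp (abs_nonpos_iff.mp h2)

/-- Elements which the relations force to be isometries have norm at most `1`. -/
theorem le_one_of_isometry (hp : IsAdmissibleSeminorm r p) {x : FreeStarAlgebra G}
    (h : r (star x * x) 1) : p x ≤ 1 := by
  have h1 := hp.eq_of_rel h
  rw [hp.star_mul_self] at h1
  nlinarith [apply_nonneg p x, hp.one_le]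

/-- Elements which the relations force to be projections have norm at most `1`. -/
theorem le_one_of_projection (hp : IsAdmissibleSeminorm r p) {x : FreeStarAlgebra G}
    (h₁ : r (star x) x) (h₂ : r (x * x) x) : p x ≤ 1 := by
  have h3 : p (star x * x) ≤ p x := by
    have e : star x * x = (star x - x) * x + (x * x - x) + x := by noncomm_ring
    have a1 : p ((star x - x) * x) ≤ 0 := by
      have := hp.mul_le (star x - x) x
      rwa [hp.rel _ _ h₁, zero_mul] at this
    have a2 := hp.rel _ _ h₂
    rw [e]
    linarith [map_add_le_add p ((star x - x) * x + (x * x - x)) x,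
      map_add_le_add p ((star x - x) * x) (x * x - x)]
  rw [hp.star_mul_self] at h3
  by_contra hlt
  nlinarith [apply_nonneg p x]

end IsAdmissibleSeminorm

namespace CStarPresentation

variable (P : CStarPresentation.{u})

/-- The C*-seminorms on the free `*`-algebra for which the relations of `P` hold. -/
abbrev AdmissibleSeminorm : Type u :=
  {p : Seminorm ℂ (FreeStarAlgebra P.Gen) // IsAdmissibleSeminorm P.Rel p}

instance : Nonempty P.AdmissibleSeminorm := ⟨⟨0, .zero _⟩⟩

theorem bddAbove (x : FreeStarAlgebra P.Gen) :
    BddAbove (Set.range fun p : P.AdmissibleSeminorm => p.1 x) := by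
  suffices h : ∃ M : ℝ, ∀ p : P.AdmissibleSeminorm, p.1 x ≤ M by
    obtain ⟨M, hM⟩ := h
    exact ⟨M, by rintro _ ⟨p, rfl⟩; exact hM p⟩
  induction x using FreeStarAlgebra.induction with
  | hc c =>
    refine ⟨‖c‖, fun p => ?_⟩
    rw [Algebra.algebraMap_eq_smul_one, map_smul_eq_mul]
    exact mul_le_of_le_one_right (norm_nonneg _) p.2.one_le
  | hg g => exact (P.bounded g).imp fun M hM p => hM p.1 p.2
  | hs g =>
    refine (P.bounded g).imp fun M hM p => ?_
    rw [← FreeStarAlgebra.star_gen, p.2.star_eq]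
    exact hM p.1 p.2
  | hm x y hx hy =>
    obtain ⟨M, hM⟩ := hx
    obtain ⟨N, hN⟩ := hy
    refine ⟨M * N, fun p => (p.2.mul_le x y).trans ?_⟩
    exact mul_le_mul (hM p) (hN p) (apply_nonneg _ _) ((apply_nonneg p.1 x).trans (hM p))
  | ha x y hx hy =>
    obtain ⟨M, hM⟩ := hx
    obtain ⟨N, hN⟩ := hy
    exact ⟨M + N, fun p => (map_add_le_add p.1 x y).trans (add_le_add (hM p) (hN p))⟩

/-- The universal norm `‖x‖ = sup_p p(x)`, over all C*-seminorms `p` on the free `*`-algebra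
for which the relations hold. -/
def universalNorm (x : FreeStarAlgebra P.Gen) : ℝ := ⨆ p : P.AdmissibleSeminorm, p.1 x

variable {P} in
theorem le_universalNorm (p : P.AdmissibleSeminorm) (x : FreeStarAlgebra P.Gen) :
    p.1 x ≤ P.universalNorm x :=
  le_ciSup (P.bddAbove x) p

theorem universalNorm_nonneg (x : FreeStarAlgebra P.Gen) : 0 ≤ P.universalNorm x :=
  Real.iSup_nonneg fun p => apply_nonneg p.1 x

/-- The free `*`-algebra equipped with the universal norm (a seminorm). -/
def Pre : Type u := FreeStarAlgebra P.Gen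

instance : Ring P.Pre := inferInstanceAs (Ring (FreeStarAlgebra P.Gen))

instance : Algebra ℂ P.Pre := inferInstanceAs (Algebra ℂ (FreeStarAlgebra P.Gen))

instance : StarRing P.Pre := inferInstanceAs (StarRing (FreeStarAlgebra P.Gen))

instance : StarModule ℂ P.Pre := inferInstanceAs (StarModule ℂ (FreeStarAlgebra P.Gen))

/-- The universal norm as a ring seminorm. -/
def ringSeminorm : RingSeminorm P.Pre where
  toFun := P.universalNorm
  map_zero' := by
    change (⨆ p : P.AdmissibleSeminorm, p.1 0) = 0
    simp
  add_le' x y := ciSup_le fun p => (map_add_le_add p.1 x y).trans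
    (add_le_add (le_universalNorm p x) (le_universalNorm p y))
  neg' x := by
    change (⨆ p : P.AdmissibleSeminorm, p.1 (-x : FreeStarAlgebra P.Gen)) =
      ⨆ p : P.AdmissibleSeminorm, p.1 x
    exact iSup_congr fun p => map_neg_eq_map p.1 x
  mul_le' x y := ciSup_le fun p => (p.2.mul_le x y).trans
    (mul_le_mul (le_universalNorm p x) (le_universalNorm p y) (apply_nonneg _ _)
      (P.universalNorm_nonneg x))

instance : SeminormedRing P.Pre := P.ringSeminorm.toSeminormedRing

theorem norm_def (x : P.Pre) : ‖x‖ = P.universalNorm x := rfl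

instance : NormedAlgebra ℂ P.Pre where
  norm_smul_le c x := ciSup_le fun p => by
    refine (map_smul_eq_mul p.1 c (x : FreeStarAlgebra P.Gen)).le.trans ?_
    exact mul_le_mul_of_nonneg_left (le_universalNorm p x) (norm_nonneg c)

theorem norm_star_pre (x : P.Pre) : ‖star x‖ = ‖x‖ :=
  iSup_congr fun p => p.2.star_eq x

theorem norm_mul_self_le_pre (x : P.Pre) : ‖x‖ * ‖x‖ ≤ ‖star x * x‖ := by
  have h : ‖x‖ ≤ Real.sqrt ‖star x * x‖ := ciSup_le fun p => by
    refine Real.le_sqrt_of_sq_le ?_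
    rw [sq, ← p.2.star_mul_self x]
    exact le_universalNorm p _
  calc ‖x‖ * ‖x‖ ≤ Real.sqrt ‖star x * x‖ * Real.sqrt ‖star x * x‖ :=
        mul_self_le_mul_self (norm_nonneg x) h
    _ = ‖star x * x‖ := Real.mul_self_sqrt (norm_nonneg _)

theorem isometry_star : Isometry (star : P.Pre → P.Pre) :=
  AddMonoidHomClass.isometry_of_norm (starAddEquiv : P.Pre ≃+ P.Pre) P.norm_star_pre

/-- The universal C*-algebra of the presentation `P`: the Hausdorff completion of the free
`*`-algebra with respect to the universal norm. -/
def UniversalCStarAlgebra : Type u := UniformSpace.Completion P.Pre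

namespace UniversalCStarAlgebra

open UniformSpace

instance : NormedRing P.UniversalCStarAlgebra := inferInstanceAs (NormedRing (Completion P.Pre))

instance : Algebra ℂ P.UniversalCStarAlgebra := inferInstanceAs (Algebra ℂ (Completion P.Pre))

instance : NormedAlgebra ℂ P.UniversalCStarAlgebra where
  norm_smul_le :=
    (norm_smul_le : ∀ (c : ℂ) (x : Completion P.Pre), ‖c • x‖ ≤ ‖c‖ * ‖x‖)

instance : CompleteSpace P.UniversalCStarAlgebra :=
  inferInstanceAs (CompleteSpace (Completion P.Pre))

variable {P} in
/-- The canonical map from the free `*`-algebra to the universal C*-algebra. -/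
def mk (x : P.Pre) : P.UniversalCStarAlgebra := (x : Completion P.Pre)

variable {P}

theorem denseRange_mk : DenseRange (mk (P := P)) := Completion.denseRange_coe

theorem continuous_mk : Continuous (mk (P := P)) := Completion.continuous_coe _

theorem norm_mk (x : P.Pre) : ‖mk x‖ = ‖x‖ := Completion.norm_coe x

theorem mk_add (x y : P.Pre) : mk (x + y) = mk x + mk y := Completion.coe_add x y

theorem mk_sub (x y : P.Pre) : mk (x - y) = mk x - mk y := Completion.coe_sub x y

theorem mk_mul (x y : P.Pre) : mk (x * y) = mk x * mk y := Completion.coe_mul x y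

theorem mk_one : mk (1 : P.Pre) = 1 := Completion.coe_one P.Pre

theorem mk_smul (c : ℂ) (x : P.Pre) : mk (c • x) = c • mk x := Completion.coe_smul c x

/-- The involution, extended by continuity. -/
instance : Star P.UniversalCStarAlgebra where
  star := Completion.map (star : P.Pre → P.Pre)

theorem mk_star (x : P.Pre) : mk (star x) = star (mk x) :=
  (Completion.map_coe P.isometry_star.uniformContinuous x).symm

theorem continuous_star' : Continuous (star : P.UniversalCStarAlgebra → P.UniversalCStarAlgebra) :=
  Completion.continuous_map

instance : StarRing P.UniversalCStarAlgebra where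
  star_involutive x := by
    induction x using denseRange_mk.induction_on with
    | hp =>
      exact isClosed_eq (continuous_star'.comp continuous_star') continuous_id
    | ih x => rw [← mk_star, ← mk_star, star_star]
  star_mul x y := by
    induction x, y using denseRange_mk.induction_on₂ with
    | hp =>
      exact isClosed_eq (continuous_star'.comp continuous_mul)
        ((continuous_star'.comp continuous_snd).mul (continuous_star'.comp continuous_fst))
    | h x y => rw [← mk_mul, ← mk_star, ← mk_star, ← mk_star, ← mk_mul, star_mul]
  star_add x y := by
    induction x, y using denseRange_mk.induction_on₂ with
    | hp =>
      exact isClosed_eq (continuous_star'.comp continuous_add)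
        ((continuous_star'.comp continuous_fst).add (continuous_star'.comp continuous_snd))
    | h x y => rw [← mk_add, ← mk_star, ← mk_star, ← mk_star, ← mk_add, star_add]

instance : CStarAlgebra P.UniversalCStarAlgebra where
  norm_mul_self_le x := by
    induction x using denseRange_mk.induction_on with
    | hp =>
      exact isClosed_le (continuous_norm.mul continuous_norm)
        (continuous_norm.comp (continuous_star'.mul continuous_id))
    | ih x =>
      rw [← mk_star, ← mk_mul, norm_mk, norm_mk]
      exact P.norm_mul_self_le_pre x
  star_smul c x := by
    induction x using denseRange_mk.induction_on with
    | hp =>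
      exact isClosed_eq (continuous_star'.comp (continuous_const_smul c))
        (continuous_star'.const_smul (star c))
    | ih x => rw [← mk_smul, ← mk_star, ← mk_star, ← mk_smul, star_smul]

/-- The image of a generator in the universal C*-algebra. -/
def gen (g : P.Gen) : P.UniversalCStarAlgebra := mk (FreeStarAlgebra.gen g : FreeStarAlgebra P.Gen)

variable (P) in
/-- `mk` as a `*`-homomorphism. -/
def mkHom : FreeStarAlgebra P.Gen →⋆ₐ[ℂ] P.UniversalCStarAlgebra where
  toFun x := mk (x : P.Pre)
  map_one' := mk_one
  map_mul' := mk_mul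
  map_zero' := Completion.coe_zero
  map_add' := mk_add
  commutes' c := by
    rw [Algebra.algebraMap_eq_smul_one, Algebra.algebraMap_eq_smul_one]
    exact (mk_smul c (1 : P.Pre)).trans (congrArg (c • ·) mk_one)
  map_star' := mk_star

theorem mkHom_gen (g : P.Gen) : mkHom P (FreeStarAlgebra.gen g) = gen g := rfl

/-- The relations hold in the universal C*-algebra. -/
theorem mkHom_eq_of_rel {x y : FreeStarAlgebra P.Gen} (h : P.Rel x y) :
    mkHom P x = mkHom P y := by
  rw [← sub_eq_zero, ← map_sub, ← norm_eq_zero]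
  refine (norm_mk (x - y : FreeStarAlgebra P.Gen)).trans (le_antisymm ?_ (norm_nonneg _))
  exact ciSup_le fun p => (p.2.rel x y h).le

/-- The C*-seminorm on the free `*`-algebra induced by a family of elements of a C*-algebra. -/
def pullback {G : Type u} {B : Type*} [CStarAlgebra B] (f : G → B) :
    Seminorm ℂ (FreeStarAlgebra G) :=
  (normSeminorm ℂ B).comp (FreeStarAlgebra.lift f : FreeStarAlgebra G →⋆ₐ[ℂ] B).toAlgHom.toLinearMap

theorem isAdmissible_pullback {B : Type*} [CStarAlgebra B] (f : P.Gen → B)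
    (hf : ∀ x y, P.Rel x y → FreeStarAlgebra.lift f x = FreeStarAlgebra.lift f y) :
    IsAdmissibleSeminorm P.Rel (pullback f) where
  mul_le x y := by
    change ‖FreeStarAlgebra.lift f (x * y)‖ ≤ _
    rw [map_mul]
    exact norm_mul_le _ _
  star_mul_self x := by
    change ‖FreeStarAlgebra.lift f (star x * x)‖ = _
    rw [map_mul, map_star]
    exact CStarRing.norm_star_mul_self
  rel x y h := by
    change ‖FreeStarAlgebra.lift f (x - y)‖ = 0
    rw [map_sub, hf x y h, sub_self, norm_zero]

/-- Two `*`-homomorphisms which agree on the generators are equal. -/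
theorem hom_ext {B : Type*} [CStarAlgebra B] {φ ψ : P.UniversalCStarAlgebra →⋆ₐ[ℂ] B}
    (h : ∀ g, φ (gen g) = ψ (gen g)) : φ = ψ := by
  have key : ∀ x : FreeStarAlgebra P.Gen, φ (mkHom P x) = ψ (mkHom P x) := fun x => by
    induction x using FreeStarAlgebra.induction with
    | hc c => rw [AlgHomClass.commutes, AlgHomClass.commutes, AlgHomClass.commutes]
    | hg g => exact h g
    | hs g => rw [← FreeStarAlgebra.star_gen, map_star, map_star, map_star, mkHom_gen, h g]
    | hm x y hx hy => rw [map_mul, map_mul, map_mul, hx, hy]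
    | ha x y hx hy => rw [map_add, map_add, map_add, hx, hy]
  refine DFunLike.coe_injective (denseRange_mk.equalizer ?_ ?_ (funext key))
  · exact AddMonoidHomClass.continuous_of_bound φ 1 fun x => by
      rw [one_mul]; exact NonUnitalStarAlgHom.norm_apply_le φ x
  · exact AddMonoidHomClass.continuous_of_bound ψ 1 fun x => by
      rw [one_mul]; exact NonUnitalStarAlgHom.norm_apply_le ψ x

/-- The universal property: a family of elements of a unital C*-algebra `B` which satisfies the
relations is the image of the generators under exactly one unital `*`-homomorphism. -/
theorem existsUnique_lift {B : Type*} [CStarAlgebra B] (f : P.Gen → B)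
    (hf : ∀ x y, P.Rel x y → FreeStarAlgebra.lift f x = FreeStarAlgebra.lift f y) :
    ∃! φ : P.UniversalCStarAlgebra →⋆ₐ[ℂ] B, ∀ g, φ (gen g) = f g := by
  let φ₀ : P.Pre →+* B := ((FreeStarAlgebra.lift f).toAlgHom : FreeStarAlgebra P.Gen →+* B)
  have hb : ∀ x : P.Pre, ‖φ₀ x‖ ≤ 1 * ‖x‖ := fun x => by
    rw [one_mul]
    exact le_universalNorm ⟨pullback f, isAdmissible_pullback f hf⟩ x
  have hc : Continuous φ₀ := AddMonoidHomClass.continuous_of_bound φ₀ 1 hb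
  let φ : P.UniversalCStarAlgebra →+* B := Completion.extensionHom φ₀ hc
  have hφc : Continuous φ := Completion.continuous_extension
  have hφ : ∀ x : FreeStarAlgebra P.Gen, φ (mkHom P x) = FreeStarAlgebra.lift f x := fun x =>
    Completion.extensionHom_coe φ₀ hc x
  refine ⟨{ φ with
      commutes' := fun c => ?_
      map_star' := fun x => ?_ }, fun g => ?_, fun ψ hψ => hom_ext fun g => (hψ g).trans ?_⟩
  · have := hφ (algebraMap ℂ _ c)
    rw [AlgHomClass.commutes (mkHom P), AlgHomClass.commutes (FreeStarAlgebra.lift f)] at this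
    exact this
  · change φ (star x) = star (φ x)
    induction x using denseRange_mk.induction_on with
    | hp => exact isClosed_eq (hφc.comp continuous_star') (continuous_star.comp hφc)
    | ih x =>
      have h1 : ∀ y : FreeStarAlgebra P.Gen, φ (star (mkHom P y)) = star (φ (mkHom P y)) :=
        fun y => by rw [← map_star, hφ, hφ, map_star]
      exact h1 x
  · exact (hφ _).trans (FreeStarAlgebra.lift_gen f g)
  · exact ((hφ _).trans (FreeStarAlgebra.lift_gen f g)).symm

end UniversalCStarAlgebra

end CStarPresentation

/-! ### The ring C*-algebra of an integral domain with finite quotients -/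

section CuntzLi

variable (R : Type u) [CommRing R]

/-- Generators: `u a` for `a ∈ R` and `s b` for regular `b ∈ R`
(for an integral domain: `b ≠ 0`). -/
inductive CuntzLiGen : Type u
  | u (a : R) : CuntzLiGen
  | s (b : R⁰) : CuntzLiGen

namespace CuntzLi

variable {R}

/-- The letter `u^a` of the free `*`-algebra. -/
def fu (a : R) : FreeStarAlgebra (CuntzLiGen R) := FreeStarAlgebra.gen (CuntzLiGen.u a)

/-- The letter `s_b` of the free `*`-algebra. -/
def fs (b : R⁰) : FreeStarAlgebra (CuntzLiGen R) := FreeStarAlgebra.gen (CuntzLiGen.s b)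

end CuntzLi

open CuntzLi in
/-- The defining relations. In `sum_eq_one`, `T` is a complete system of representatives for
`R / (b)`. -/
inductive CuntzLiRel :
    FreeStarAlgebra (CuntzLiGen R) → FreeStarAlgebra (CuntzLiGen R) → Prop
  | star_u_mul_u (a : R) : CuntzLiRel (star (fu a) * fu a) 1
  | u_mul_star_u (a : R) : CuntzLiRel (fu a * star (fu a)) 1
  | star_s_mul_s (b : R⁰) : CuntzLiRel (star (fs b) * fs b) 1
  | u_zero : CuntzLiRel (fu 0) 1
  | mul (a c : R) (b d : R⁰) :
      CuntzLiRel (fu a * fs b * fu c * fs d) (fu (a + b * c) * fs (b * d))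
  | sum_eq_one (b : R⁰) (T : Finset R)
      (hT : ∀ r : R, ∃! t, t ∈ T ∧ r - t ∈ Ideal.span {(b : R)}) :
      CuntzLiRel (∑ t ∈ T, fu t * fs b * star (fs b) * fu (-t)) 1

/-- Generators and relations of the Cuntz–Li algebra. -/
def cuntzLiPresentation : CStarPresentation.{u} where
  Gen := CuntzLiGen R
  Rel := CuntzLiRel R
  bounded g := ⟨1, fun p hp => by
    cases g with
    | u a => exact hp.le_one_of_isometry (.star_u_mul_u a)
    | s b => exact hp.le_one_of_isometry (.star_s_mul_s b)⟩

/-- The Cuntz–Li algebra `𝔄[R]`: the universal C*-algebra generated by unitaries `u^a`, `a ∈ R`,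
and isometries `s_b`, `b ∈ R` regular, subject to `u^0 = 1`,
`u^a s_b u^c s_d = u^(a+bc) s_(bd)` and `∑_{a+(b) ∈ R/(b)} u^a s_b s_b* u^(-a) = 1`. -/
abbrev CuntzLiAlgebra : Type u := (cuntzLiPresentation R).UniversalCStarAlgebra

namespace CuntzLiAlgebra

variable {R}

/-- The unitary `u^a` in `𝔄[R]`. -/
def u (a : R) : CuntzLiAlgebra R :=
  CStarPresentation.UniversalCStarAlgebra.gen (P := cuntzLiPresentation R) (CuntzLiGen.u a)

/-- The isometry `s_b` in `𝔄[R]`. -/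
def s (b : R⁰) : CuntzLiAlgebra R :=
  CStarPresentation.UniversalCStarAlgebra.gen (P := cuntzLiPresentation R) (CuntzLiGen.s b)

end CuntzLiAlgebra

end CuntzLi

/-! ### The ring C*-algebra of a ring with respect to an algebra of subsets -/

section RingCStar

/-- The affine image `a + b X`. -/
def affineImage {R : Type u} [Ring R] (a b : R) (X : Set R) : Set R := (fun x => a + b * x) '' X

/-- An algebra of subsets of `R` which is invariant under the injective affine transformations
`x ↦ a + b x`, `b` regular. -/
structure InvariantSetAlgebra (R : Type u) [Ring R] where
  sets : Set (Set R)
  isSetAlgebra : MeasureTheory.IsSetAlgebra sets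
  affine_mem : ∀ (a : R) (b : R⁰) (X : Set R), X ∈ sets → affineImage a (b : R) X ∈ sets

/-- The smallest invariant algebra of subsets of `R` containing the family `F`. -/
def InvariantSetAlgebra.generate {R : Type u} [Ring R] (F : Set (Set R)) :
    InvariantSetAlgebra R where
  sets := {X | ∀ C : InvariantSetAlgebra R, F ⊆ C.sets → X ∈ C.sets}
  isSetAlgebra :=
    { empty_mem := fun C _ => C.isSetAlgebra.empty_mem
      compl_mem := fun _ hX C hC => C.isSetAlgebra.compl_mem (hX C hC)
      union_mem := fun _ _ hX hY C hC => C.isSetAlgebra.union_mem (hX C hC) (hY C hC) }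
  affine_mem a b X hX C hC := C.affine_mem a b X (hX C hC)

variable {R : Type u} [Ring R] (C : InvariantSetAlgebra R)

/-- Generators: `e X` for `X ∈ C`, `u a` for `a ∈ R` and `s b` for regular `b ∈ R`. -/
inductive RingCStarGen : Type u
  | e (X : C.sets) : RingCStarGen
  | u (a : R) : RingCStarGen
  | s (b : R⁰) : RingCStarGen

namespace RingCStar

variable {C}

/-- The letter `e_X` of the free `*`-algebra. -/
def fe (X : C.sets) : FreeStarAlgebra (RingCStarGen C) := FreeStarAlgebra.gen (RingCStarGen.e X)

/-- The letter `u^a` of the free `*`-algebra. -/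
def fu (a : R) : FreeStarAlgebra (RingCStarGen C) := FreeStarAlgebra.gen (RingCStarGen.u a)

/-- The letter `s_b` of the free `*`-algebra. -/
def fs (b : R⁰) : FreeStarAlgebra (RingCStarGen C) := FreeStarAlgebra.gen (RingCStarGen.s b)

end RingCStar

open RingCStar in
/-- The defining relations. -/
inductive RingCStarRel :
    FreeStarAlgebra (RingCStarGen C) → FreeStarAlgebra (RingCStarGen C) → Prop
  | star_e (X : C.sets) : RingCStarRel (star (fe X)) (fe X)
  | e_mul_self (X : C.sets) : RingCStarRel (fe X * fe X) (fe X)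
  | star_u_mul_u (a : R) : RingCStarRel (star (fu a) * fu a) 1
  | u_mul_star_u (a : R) : RingCStarRel (fu a * star (fu a)) 1
  | star_s_mul_s (b : R⁰) : RingCStarRel (star (fs b) * fs b) 1
  | u_zero : RingCStarRel (fu 0) 1
  | mul (a c : R) (b d : R⁰) :
      RingCStarRel (fu a * fs b * fu c * fs d) (fu (a + b * c) * fs (b * d))
  | ad (a : R) (b : R⁰) (X : C.sets) :
      RingCStarRel (fu a * fs b * fe X * star (fu a * fs b))
        (fe ⟨affineImage a (b : R) X, C.affine_mem a b X X.2⟩)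
  | e_univ : RingCStarRel (fe ⟨Set.univ, C.isSetAlgebra.univ_mem⟩) 1
  | e_inter (X Y : C.sets) :
      RingCStarRel (fe X * fe Y) (fe ⟨X ∩ Y, C.isSetAlgebra.inter_mem X.2 Y.2⟩)
  | e_union (X Y : C.sets) (h : Disjoint (X : Set R) (Y : Set R)) :
      RingCStarRel (fe ⟨X ∪ Y, C.isSetAlgebra.union_mem X.2 Y.2⟩) (fe X + fe Y)

/-- Generators and relations of the full ring C*-algebra. -/
def ringCStarPresentation : CStarPresentation.{u} where
  Gen := RingCStarGen C
  Rel := RingCStarRel C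
  bounded g := ⟨1, fun p hp => by
    cases g with
    | e X => exact hp.le_one_of_projection (.star_e X) (.e_mul_self X)
    | u a => exact hp.le_one_of_isometry (.star_u_mul_u a)
    | s b => exact hp.le_one_of_isometry (.star_s_mul_s b)⟩

/-- The full ring C*-algebra `𝔄[R, C]`: the universal C*-algebra generated by projections `e_X`,
`X ∈ C`, unitaries `u^a`, `a ∈ R`, and isometries `s_b`, `b ∈ R` regular, subject to `u^0 = 1`,
`u^a s_b u^c s_d = u^(a+bc) s_(bd)`, `(u^a s_b) e_X (u^a s_b)* = e_(a+bX)`, `e_R = 1`,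
`e_X e_Y = e_(X ∩ Y)`, and `e_(X ∪ Y) = e_X + e_Y` for disjoint `X`, `Y`. -/
abbrev RingCStarAlgebra : Type u := (ringCStarPresentation C).UniversalCStarAlgebra

namespace RingCStarAlgebra

/-- The projection `e_X` in `𝔄[R, C]`. -/
def e (X : C.sets) : RingCStarAlgebra C :=
  CStarPresentation.UniversalCStarAlgebra.gen (P := ringCStarPresentation C) (RingCStarGen.e X)

/-- The unitary `u^a` in `𝔄[R, C]`. -/
def u (a : R) : RingCStarAlgebra C :=
  CStarPresentation.UniversalCStarAlgebra.gen (P := ringCStarPresentation C) (RingCStarGen.u a)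

/-- The isometry `s_b` in `𝔄[R, C]`. -/
def s (b : R⁰) : RingCStarAlgebra C :=
  CStarPresentation.UniversalCStarAlgebra.gen (P := ringCStarPresentation C) (RingCStarGen.s b)

end RingCStarAlgebra

/-- `C(F)` for a family `F` of ideals of a commutative ring: the smallest invariant algebra of
subsets of `R` which contains (the underlying sets of) all members of `F`. -/
def idealSetAlgebra {R : Type u} [CommRing R] (F : Set (Ideal R)) : InvariantSetAlgebra R :=
  InvariantSetAlgebra.generate ((fun I : Ideal R => (I : Set R)) '' F)

end RingCStar

end

/-! In `𝔄[R]` the projections `e_X` can be reconstructed. Every nonzero ideal contains a principal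
ideal `(c)` with `c ≠ 0`, and complements, finite unions and injective affine images of sets
periodic modulo some nonzero element are again of this kind. Hence every `X` in `C(F)` is periodic
modulo some `c ≠ 0` and, as `R / (c)` is finite, is a finite disjoint union of classes `t + (c)`.
This forces `e_X = ∑ u^t s_c s_c* u^(-t)`, the sum running over representatives of these classes.

The sum does not depend on choices. Congruent representatives give the same range projection
(`rangeProj_congr`). Conjugating the sum relation for `d` by `u^t s_c` splits a class modulo `c`
into classes modulo `c d` (`sum_refine`), so two descriptions of `X` agree at a common modulus
(`setProj_eq`). Projections with sum `1` are orthogonal, whence `e_X e_Y = e_(X ∩ Y)`; the other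
relations are checked on one transversal. This gives a homomorphism from the algebra with the `e_X`
to `𝔄[R]`.

Conversely, in the algebra with the `e_X`, covariance and `e_R = 1` give `u^t s_c s_c* u^(-t) = e_(t
+ (c))`. Finite additivity then yields the sum relation, and more generally the formula for every
`e_X` (`sum_rangeProj_eq_e`). The two homomorphisms are therefore inverse to each other on
generators. -/

noncomputable section

/-! ### Finite transversals modulo a principal ideal -/

/-- `X` is the disjoint union of the residue classes `t + (c)`, `t ∈ S`. -/
structure IsTransversal {R : Type u} [CommRing R] (c : R) (X : Set R) (S : Finset R) : Prop where
  mem_iff : ∀ x, x ∈ X ↔ ∃ t ∈ S, c ∣ x - t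
  eq_of_dvd : ∀ t ∈ S, ∀ t' ∈ S, c ∣ t - t' → t = t'

namespace IsTransversal

variable {R : Type u} [CommRing R] {c d : R} {X Y : Set R} {S T : Finset R}

theorem mem (h : IsTransversal c X S) {t : R} (ht : t ∈ S) : t ∈ X :=
  (h.mem_iff t).2 ⟨t, ht, by simp⟩

theorem mem_of_dvd (h : IsTransversal c X S) {x y : R} (hx : x ∈ X) (hxy : c ∣ y - x) : y ∈ X := by
  obtain ⟨t, ht, h1⟩ := (h.mem_iff x).1 hx
  exact (h.mem_iff y).2 ⟨t, ht, by simpa using dvd_add hxy h1⟩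

theorem existsUnique (h : IsTransversal c Set.univ T) (r : R) :
    ∃! t, t ∈ T ∧ r - t ∈ Ideal.span {c} := by
  obtain ⟨t, ht, h1⟩ := (h.mem_iff r).1 trivial
  refine ⟨t, ⟨ht, Ideal.mem_span_singleton.2 h1⟩, fun t' ⟨ht', h2⟩ => ?_⟩
  refine h.eq_of_dvd _ ht' _ ht ?_
  simpa using dvd_sub h1 (Ideal.mem_span_singleton.1 h2)

theorem of_existsUnique (h : ∀ r : R, ∃! t, t ∈ T ∧ r - t ∈ Ideal.span {c}) :
    IsTransversal c Set.univ T where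
  mem_iff x := by
    obtain ⟨t, ⟨ht, h1⟩, -⟩ := h x
    exact ⟨fun _ => ⟨t, ht, Ideal.mem_span_singleton.1 h1⟩, fun _ => trivial⟩
  eq_of_dvd t ht t' ht' hd := by
    obtain ⟨a, -, ha⟩ := h t
    rw [ha t ⟨ht, by simp⟩, ha t' ⟨ht', Ideal.mem_span_singleton.2 hd⟩]

/-- Finiteness of the quotient enters here: one representative is chosen in each class. -/
theorem exists_univ (c : R) [Finite (R ⧸ Ideal.span {c})] :
    ∃ T : Finset R, IsTransversal c Set.univ T := by
  classical
  have := Fintype.ofFinite (R ⧸ Ideal.span {c})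
  have hout : ∀ q : R ⧸ Ideal.span {c}, Ideal.Quotient.mk _ q.out = q := fun q => Quotient.out_eq q
  have hmk : ∀ x y : R, Ideal.Quotient.mk (Ideal.span {c}) x = Ideal.Quotient.mk _ y ↔ c ∣ x - y :=
    fun x y => by rw [Ideal.Quotient.eq, Ideal.mem_span_singleton]
  refine ⟨Finset.univ.image fun q : R ⧸ Ideal.span {c} => q.out, fun x => ?_, ?_⟩
  · refine ⟨fun _ => ⟨_, Finset.mem_image_of_mem _
      (Finset.mem_univ (Ideal.Quotient.mk (Ideal.span {c}) x)), ?_⟩, fun _ => trivial⟩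
    rw [← hmk, hout]
  · simp only [Finset.mem_image, Finset.mem_univ, true_and]
    rintro _ ⟨q, rfl⟩ _ ⟨q', rfl⟩ h
    rw [← hmk, hout, hout] at h
    rw [h]

-- A `c`-periodic set contains a residue class as soon as it contains its representative, so the
-- representatives lying in `X` suffice.
open Classical in
theorem filter (h : IsTransversal c Set.univ T) (hX : ∀ x ∈ X, ∀ r, x + c * r ∈ X) :
    IsTransversal c X (T.filter (· ∈ X)) where
  mem_iff x := by
    constructor
    · intro hx
      obtain ⟨t, ht, r, hr⟩ := (h.mem_iff x).1 trivial
      refine ⟨t, Finset.mem_filter.2 ⟨ht, ?_⟩, r, hr⟩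
      have := hX x hx (-r)
      rwa [mul_neg, ← hr, ← sub_eq_add_neg, sub_sub_cancel] at this
    · rintro ⟨t, ht, r, hr⟩
      have := hX t (Finset.mem_filter.1 ht).2 r
      rwa [← hr, add_sub_cancel] at this
  eq_of_dvd t ht t' ht' := h.eq_of_dvd t (Finset.mem_filter.1 ht).1 t' (Finset.mem_filter.1 ht').1

open Classical in
theorem union (hX : IsTransversal c X S) (hY : IsTransversal c Y T) (hXY : Disjoint X Y) :
    IsTransversal c (X ∪ Y) (S ∪ T) where
  mem_iff x := by
    rw [Set.mem_union, hX.mem_iff, hY.mem_iff]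
    simp only [Finset.mem_union, or_and_right, exists_or]
  eq_of_dvd t ht t' ht' hd := by
    rcases Finset.mem_union.1 ht with h | h <;> rcases Finset.mem_union.1 ht' with h' | h'
    · exact hX.eq_of_dvd t h t' h' hd
    · exact (Set.disjoint_left.1 hXY (hX.mem h) (hY.mem_of_dvd (hY.mem h') hd)).elim
    · exact (Set.disjoint_left.1 hXY (hX.mem_of_dvd (hX.mem h') hd) (hY.mem h)).elim
    · exact hY.eq_of_dvd t h t' h' hd

open Classical in
theorem affineImage [IsDomain R] (hX : IsTransversal c X S) (a : R) {b : R} (hb : b ≠ 0) :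
    IsTransversal (b * c) (affineImage a b X) (S.image fun t => a + b * t) where
  mem_iff x := by
    simp only [Finset.mem_image, exists_exists_and_eq_and]
    constructor
    · rintro ⟨y, hy, rfl⟩
      obtain ⟨t, ht, h⟩ := (hX.mem_iff y).1 hy
      refine ⟨t, ht, ?_⟩
      have := mul_dvd_mul_left b h
      rwa [mul_sub, ← add_sub_add_left_eq_sub _ _ a] at this
    · rintro ⟨t, ht, r, hr⟩
      refine ⟨t + c * r, (hX.mem_iff _).2 ⟨t, ht, by simp⟩, ?_⟩
      change a + b * (t + c * r) = x
      linear_combination -hr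
  eq_of_dvd := by
    simp only [Finset.mem_image]
    rintro _ ⟨t, ht, rfl⟩ _ ⟨t', ht', rfl⟩ h
    rw [add_sub_add_left_eq_sub, ← mul_sub, mul_dvd_mul_iff_left hb] at h
    rw [hX.eq_of_dvd t ht t' ht' h]

/-- Uniqueness of the two digits in `t + c r`: reduction modulo `c` determines `t`, and cancelling
`c` then determines `r` modulo `d`. -/
theorem add_mul_inj [IsDomain R] (hc : c ≠ 0) (hX : IsTransversal c X S)
    (hT : IsTransversal d Set.univ T) {t t' r r' : R} (ht : t ∈ S) (ht' : t' ∈ S) (hr : r ∈ T)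
    (hr' : r' ∈ T) (h : c * d ∣ (t + c * r) - (t' + c * r')) : t = t' ∧ r = r' := by
  have e : t = t' := by
    refine hX.eq_of_dvd t ht t' ht' ?_
    have := dvd_sub ((dvd_mul_right c d).trans h) (dvd_mul_right c (r - r'))
    rwa [show t + c * r - (t' + c * r') - c * (r - r') = t - t' by ring] at this
  subst e
  rw [add_sub_add_left_eq_sub, ← mul_sub, mul_dvd_mul_iff_left hc] at h
  exact ⟨rfl, hT.eq_of_dvd r hr r' hr' h⟩

open Classical in
theorem refine [IsDomain R] (hc : c ≠ 0) (hX : IsTransversal c X S)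
    (hT : IsTransversal d Set.univ T) :
    IsTransversal (c * d) X ((S ×ˢ T).image fun p => p.1 + c * p.2) where
  mem_iff x := by
    simp only [Finset.mem_image, Finset.mem_product, Prod.exists]
    constructor
    · intro hx
      obtain ⟨t, ht, k, hk⟩ := (hX.mem_iff x).1 hx
      obtain ⟨r, hr, l, hl⟩ := (hT.mem_iff k).1 trivial
      exact ⟨_, ⟨t, r, ⟨ht, hr⟩, rfl⟩, l, by linear_combination hk + c * hl⟩
    · rintro ⟨_, ⟨t, r, ⟨ht, -⟩, rfl⟩, k, hk⟩
      exact (hX.mem_iff x).2 ⟨t, ht, r + d * k, by linear_combination hk⟩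
  eq_of_dvd := by
    simp only [Finset.mem_image, Finset.mem_product, Prod.exists]
    rintro _ ⟨t, r, ⟨ht, hr⟩, rfl⟩ _ ⟨t', r', ⟨ht', hr'⟩, rfl⟩ h
    obtain ⟨rfl, rfl⟩ := hX.add_mul_inj hc hT ht ht' hr hr' h
    rfl

end IsTransversal

/-! ### Orthogonality of projections with sum one -/

/-- Self-adjoint idempotents of a C*-algebra with sum `1` are pairwise orthogonal. -/
theorem mul_eq_zero_of_sum_projections_eq_one {A ι : Type*} [CStarAlgebra A] {T : Finset ι}
    {p : ι → A} (hs : ∀ i ∈ T, star (p i) = p i) (hp : ∀ i ∈ T, p i * p i = p i)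
    (h1 : ∑ i ∈ T, p i = 1) {i j : ι} (hi : i ∈ T) (hj : j ∈ T) (hij : i ≠ j) :
    p j * p i = 0 := by
  classical
  let _ := CStarAlgebra.spectralOrder A
  have := CStarAlgebra.spectralOrderedRing A
  -- Each compression `p i * p k * p i` has the form `star x * x`, hence is positive.
  have key : ∀ k ∈ T, p i * p k * p i = star (p k * p i) * (p k * p i) := fun k hk => by
    rw [star_mul, hs i hi, hs k hk, mul_assoc (p i) (p k) (p k * p i), ← mul_assoc (p k) (p k),
      hp k hk, mul_assoc]
  -- Compressing the relation `∑ p k = 1` by `p i` gives `p i` on both sides; the term `k = i`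
  -- already accounts for it, so the remaining positive terms sum to zero and each one vanishes.
  have h0 : ∑ k ∈ T.erase i, p i * p k * p i = 0 := by
    have h2 : ∑ k ∈ T, p i * p k * p i = p i := by
      rw [← Finset.sum_mul, ← Finset.mul_sum, h1, mul_one, hp i hi]
    rw [← Finset.add_sum_erase T _ hi, hp i hi, hp i hi] at h2
    exact left_eq_add.1 h2.symm
  have h3 := (Finset.sum_eq_zero_iff_of_nonneg fun k hk => by
    rw [key k (Finset.mem_of_mem_erase hk)]; exact star_mul_self_nonneg _).1 h0 j
      (Finset.mem_erase.2 ⟨hij.symm, hj⟩)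
  rw [key j hj] at h3
  exact CStarRing.star_mul_self_eq_zero_iff _ |>.1 h3

/-! ### Representations of the affine semigroup by isometries -/

/-- Unitaries `u a` and isometries `s b` with `u 0 = 1` and
`u a * s b * u c * s d = u (a + b * c) * s (b * d)`. -/
structure IsAffineFamily {R : Type u} [CommRing R] {A : Type*} [Ring A] [StarRing A]
    (u : R → A) (s : R⁰ → A) : Prop where
  star_u_mul_u : ∀ a, star (u a) * u a = 1
  u_mul_star_u : ∀ a, u a * star (u a) = 1
  star_s_mul_s : ∀ b, star (s b) * s b = 1
  u_zero : u 0 = 1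
  mul : ∀ a c b d, u a * s b * u c * s d = u (a + b * c) * s (b * d)

/-- The range projection of `u a * s b`. -/
def rangeProj {R : Type u} [CommRing R] {A : Type*} [Ring A] [StarRing A]
    (u : R → A) (s : R⁰ → A) (a : R) (b : R⁰) : A := u a * s b * star (u a * s b)

namespace IsAffineFamily

section Ring

variable {R : Type u} [CommRing R] {A : Type*} [Ring A] [StarRing A] {u : R → A} {s : R⁰ → A}

/-- The product relation makes `s 1` idempotent, and an idempotent isometry is `1`. -/
theorem s_one (h : IsAffineFamily u s) : s 1 = 1 := by
  have h1 := h.mul 0 0 1 1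
  simp only [h.u_zero, one_mul, mul_one, mul_zero, add_zero] at h1
  have h2 := congrArg (star (s 1) * ·) h1
  simpa only [← mul_assoc, h.star_s_mul_s, one_mul] using h2

theorem u_add (h : IsAffineFamily u s) (a c : R) : u (a + c) = u a * u c := by
  simpa [h.s_one] using (h.mul a c 1 1).symm

theorem star_u (h : IsAffineFamily u s) (a : R) : star (u a) = u (-a) := by
  have h1 : u a * u (-a) = 1 := by rw [← h.u_add, add_neg_cancel, h.u_zero]
  calc star (u a) = star (u a) * (u a * u (-a)) := by rw [h1, mul_one]
    _ = u (-a) := by rw [← mul_assoc, h.star_u_mul_u, one_mul]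

theorem star_mul_self (h : IsAffineFamily u s) (a : R) (b : R⁰) :
    star (u a * s b) * (u a * s b) = 1 := by
  rw [star_mul, mul_assoc, ← mul_assoc (star (u a)), h.star_u_mul_u, one_mul, h.star_s_mul_s]

theorem star_rangeProj (a : R) (b : R⁰) : star (rangeProj u s a b) = rangeProj u s a b := by
  rw [rangeProj, star_mul, star_star]

theorem rangeProj_mul_self (h : IsAffineFamily u s) (a : R) (b : R⁰) :
    rangeProj u s a b * rangeProj u s a b = rangeProj u s a b := by
  rw [rangeProj, mul_assoc, ← mul_assoc (star _), h.star_mul_self, one_mul]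

theorem rangeProj_eq (h : IsAffineFamily u s) (a : R) (b : R⁰) :
    rangeProj u s a b = u a * s b * star (s b) * u (-a) := by
  rw [rangeProj, star_mul, h.star_u, ← mul_assoc]

/-- The product relation multiplies the two isometries. This identity yields both the covariance of
the `e_X` and the passage to a finer modulus. -/
theorem conj_rangeProj (h : IsAffineFamily u s) (a c : R) (b d : R⁰) :
    u a * s b * rangeProj u s c d * star (u a * s b) = rangeProj u s (a + b * c) (b * d) := by
  rw [rangeProj, rangeProj, ← h.mul]
  simp only [star_mul, mul_assoc]

/-- Since `u (a' + b * r) * s b = u a' * s b * u r`, changing the representative multiplies the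
isometry on the right by a unitary, which leaves the range projection unchanged. -/
theorem rangeProj_congr (h : IsAffineFamily u s) {a a' : R} {b : R⁰} (hd : (b : R) ∣ a - a') :
    rangeProj u s a b = rangeProj u s a' b := by
  obtain ⟨r, hr⟩ := hd
  obtain rfl : a = a' + b * r := by linear_combination hr
  have h1 := h.mul a' r b 1
  rw [h.s_one, mul_one, mul_one] at h1
  rw [rangeProj, rangeProj, ← h1, star_mul _ (u r), mul_assoc, ← mul_assoc (u r), h.u_mul_star_u,
    one_mul]

end Ring

/-! ### The projections attached to finite unions of residue classes -/

/-- The projection of a set which has a finite transversal. -/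
def setProj {R : Type u} [CommRing R] {A : Type*} [Ring A] [StarRing A]
    (u : R → A) (s : R⁰ → A) (X : Set R) : A :=
  open Classical in
  -- The modulus and transversal are arbitrary; `setProj_eq` removes the choice. The value `0` is a
  -- default for sets without a finite transversal.
  if h : ∃ q : R⁰ × Finset R, IsTransversal (q.1 : R) X q.2 then
    ∑ t ∈ h.choose.2, rangeProj u s t h.choose.1
  else 0

variable {R : Type u} [CommRing R] {A : Type*} [CStarAlgebra A]
  {u : R → A} {s : R⁰ → A} {X Y : Set R} {S S' T : Finset R} {c d : R⁰}

/-- Two transversals for the same modulus correspond bijectively by congruence, and congruent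
representatives have equal range projections. -/
theorem sum_congr (h : IsAffineFamily u s) (hS : IsTransversal (c : R) X S)
    (hS' : IsTransversal (c : R) X S') :
    ∑ t ∈ S, rangeProj u s t c = ∑ t ∈ S', rangeProj u s t c := by
  have hex : ∀ {P Q : Finset R}, IsTransversal (c : R) X P → IsTransversal (c : R) X Q →
      ∀ t ∈ P, ∃ t' ∈ Q, (c : R) ∣ t - t' := fun hP hQ t ht => (hQ.mem_iff t).1 (hP.mem ht)
  choose! f hf hfd using hex hS hS'
  refine Finset.sum_bij (fun t _ => f t) (fun t ht => hf t ht) ?_ ?_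
    fun t ht => h.rangeProj_congr (hfd t ht)
  · intro t ht t' ht' hff
    refine hS.eq_of_dvd t ht t' ht' ?_
    have h2 := hfd t' ht'
    rw [← hff] at h2
    simpa using dvd_sub (hfd t ht) h2
  · intro t' ht'
    obtain ⟨t, ht, hd⟩ := hex hS' hS t' ht'
    refine ⟨t, ht, hS'.eq_of_dvd _ (hf t ht) _ ht' ?_⟩
    have := dvd_add (hfd t ht) hd
    rw [← dvd_neg]
    convert this using 1
    ring

variable [IsDomain R]

theorem sum_refine (h : IsAffineFamily u s)
    (h1 : ∀ (b : R⁰) (T : Finset R), IsTransversal (b : R) Set.univ T →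
      ∑ t ∈ T, rangeProj u s t b = 1)
    (hS : IsTransversal (c : R) X S) (hT : IsTransversal (d : R) Set.univ T)
    (hS' : IsTransversal ((c * d : R⁰) : R) X S') :
    ∑ t ∈ S, rangeProj u s t c = ∑ t ∈ S', rangeProj u s t (c * d) := by
  classical
  have hc : (c : R) ≠ 0 := nonZeroDivisors.coe_ne_zero c
  rw [h.sum_congr hS' (hS.refine hc hT), Finset.sum_image, Finset.sum_product]
  -- For fixed `t`, the inner sum over `r` is the sum relation for `d` conjugated by `u t * s c`, so
  -- it collapses to the range projection at `t`.
  · refine Finset.sum_congr rfl fun t _ => ?_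
    simp only [← h.conj_rangeProj]
    rw [← Finset.sum_mul, ← Finset.mul_sum, h1 d T hT, mul_one, rangeProj]
  · rintro ⟨t, r⟩ hp ⟨t', r'⟩ hp' he
    rw [Finset.mem_coe, Finset.mem_product] at hp hp'
    obtain ⟨h3, h4⟩ := hS.add_mul_inj hc hT hp.1 hp'.1 hp.2 hp'.2
      (by simp [show t + c * r = t' + c * r' from he])
    exact Prod.ext h3 h4

/-- The given and the chosen description are both refined to one transversal modulo the product of
the two moduli. -/
theorem setProj_eq (h : IsAffineFamily u s)
    (hfin : ∀ b : R⁰, ∃ T : Finset R, IsTransversal (b : R) Set.univ T)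
    (h1 : ∀ (b : R⁰) (T : Finset R), IsTransversal (b : R) Set.univ T →
      ∑ t ∈ T, rangeProj u s t b = 1)
    (hS : IsTransversal (c : R) X S) : setProj u s X = ∑ t ∈ S, rangeProj u s t c := by
  classical
  have hex : ∃ q : R⁰ × Finset R, IsTransversal (q.1 : R) X q.2 := ⟨(c, S), hS⟩
  rw [setProj, dif_pos hex]
  have hS' := hex.choose_spec
  generalize hex.choose = q at hS'
  obtain ⟨T, hT⟩ := hfin c
  obtain ⟨T', hT'⟩ := hfin q.1
  have hr := hS.refine (nonZeroDivisors.coe_ne_zero c) hT'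
  rw [h.sum_refine h1 hS hT' hr, mul_comm c,
    h.sum_refine h1 hS' hT (by rwa [mul_comm, Submonoid.coe_mul])]

end IsAffineFamily

/-! ### Sets which are periodic modulo a nonzero element -/

/-- The algebra of all subsets `X` with `X + (c) = X` for some `c ≠ 0`. -/
def periodicSetAlgebra (R : Type u) [CommRing R] [IsDomain R] : InvariantSetAlgebra R where
  sets := {X | ∃ c : R⁰, ∀ x ∈ X, ∀ r, x + c * r ∈ X}
  isSetAlgebra :=
    { empty_mem := ⟨1, by simp⟩
      compl_mem := by
        rintro X ⟨c, hc⟩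
        -- The complement has the same period: a translate falling into `X` could be translated back
        -- by `-r`.
        refine ⟨c, fun x hx r hxr => hx ?_⟩
        simpa using hc _ hxr (-r)
      union_mem := by
        rintro X Y ⟨c, hc⟩ ⟨d, hd⟩
        refine ⟨c * d, ?_⟩
        rintro x (hx | hx) r
        · exact .inl (by simpa [mul_assoc] using hc x hx (d * r))
        · exact .inr (by simpa [mul_assoc, mul_left_comm] using hd x hx (c * r)) }
  affine_mem := by
    rintro a b X ⟨c, hc⟩
    refine ⟨b * c, ?_⟩
    rintro _ ⟨x, hx, rfl⟩ r
    exact ⟨x + c * r, hc x hx r, by simp; ring⟩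

/-- By minimality of `C(F)` only its generators need a period, and any nonzero element of an ideal
is one. -/
theorem exists_period_of_mem_idealSetAlgebra {R : Type u} [CommRing R] [IsDomain R]
    {F : Set (Ideal R)} (hF : ∀ I ∈ F, I ≠ ⊥) {X : Set R} (hX : X ∈ (idealSetAlgebra F).sets) :
    ∃ c : R⁰, ∀ x ∈ X, ∀ r, x + c * r ∈ X := by
  refine hX (periodicSetAlgebra R) ?_
  rintro _ ⟨I, hI, rfl⟩
  obtain ⟨c, hc, h0⟩ := Submodule.exists_mem_ne_zero_of_ne_bot (hF I hI)
  exact ⟨⟨c, mem_nonZeroDivisors_of_ne_zero h0⟩, fun x hx r => I.add_mem hx (I.mul_mem_right r hc)⟩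

/-! ### The projections `e_X` in the Cuntz–Li algebra -/

namespace CuntzLiAlgebra

open CStarPresentation.UniversalCStarAlgebra IsAffineFamily

variable {R : Type u} [CommRing R]

variable (R) in
/-- The canonical map from the free `*`-algebra. -/
def ofFree : FreeStarAlgebra (CuntzLiGen R) →⋆ₐ[ℂ] CuntzLiAlgebra R :=
  mkHom (cuntzLiPresentation R)

theorem ofFree_eq {x y : FreeStarAlgebra (CuntzLiGen R)} (h : CuntzLiRel R x y) :
    ofFree R x = ofFree R y :=
  mkHom_eq_of_rel (P := cuntzLiPresentation R) h

theorem ofFree_fu (a : R) : ofFree R (CuntzLi.fu a) = u a := rfl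

theorem ofFree_fs (b : R⁰) : ofFree R (CuntzLi.fs b) = s b := rfl

theorem isAffineFamily : IsAffineFamily (u : R → CuntzLiAlgebra R) s where
  star_u_mul_u a := by
    simpa only [ofFree_fu, ofFree_fs, map_mul, map_star, map_one] using
      ofFree_eq (CuntzLiRel.star_u_mul_u a)
  u_mul_star_u a := by
    simpa only [ofFree_fu, ofFree_fs, map_mul, map_star, map_one] using
      ofFree_eq (CuntzLiRel.u_mul_star_u a)
  star_s_mul_s b := by
    simpa only [ofFree_fu, ofFree_fs, map_mul, map_star, map_one] using
      ofFree_eq (CuntzLiRel.star_s_mul_s b)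
  u_zero := by
    simpa only [ofFree_fu, ofFree_fs, map_one] using ofFree_eq CuntzLiRel.u_zero
  mul a c b d := by
    simpa only [ofFree_fu, ofFree_fs, map_mul] using
      ofFree_eq (CuntzLiRel.mul a c b d)

theorem sum_rangeProj (b : R⁰) (T : Finset R) (hT : IsTransversal (b : R) Set.univ T) :
    ∑ t ∈ T, rangeProj (u : R → CuntzLiAlgebra R) s t b = 1 := by
  have h := ofFree_eq (.sum_eq_one b T hT.existsUnique)
  simp only [ofFree_fu, ofFree_fs, map_sum, map_mul, map_star, map_one] at h
  simpa only [isAffineFamily.rangeProj_eq] using h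

end CuntzLiAlgebra

/-! ### Residue classes and the projections `e_X` in the full ring C*-algebra -/

namespace RingCStarAlgebra

open CStarPresentation.UniversalCStarAlgebra

variable {R : Type u} [CommRing R] (C : InvariantSetAlgebra R)

/-- The canonical map from the free `*`-algebra. -/
def ofFree : FreeStarAlgebra (RingCStarGen C) →⋆ₐ[ℂ] RingCStarAlgebra C :=
  mkHom (ringCStarPresentation C)

theorem ofFree_eq {x y : FreeStarAlgebra (RingCStarGen C)} (h : RingCStarRel C x y) :
    ofFree C x = ofFree C y :=
  mkHom_eq_of_rel (P := ringCStarPresentation C) h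

theorem ofFree_fe (X : C.sets) : ofFree C (RingCStar.fe X) = e C X := rfl

theorem ofFree_fu (a : R) : ofFree C (RingCStar.fu a) = u C a := rfl

theorem ofFree_fs (b : R⁰) : ofFree C (RingCStar.fs b) = s C b := rfl

theorem isAffineFamily : IsAffineFamily (u C) (s C) where
  star_u_mul_u a := by
    simpa only [ofFree_fe, ofFree_fu, ofFree_fs, map_mul, map_star, map_one] using
      ofFree_eq C (RingCStarRel.star_u_mul_u a)
  u_mul_star_u a := by
    simpa only [ofFree_fe, ofFree_fu, ofFree_fs, map_mul, map_star, map_one] using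
      ofFree_eq C (RingCStarRel.u_mul_star_u a)
  star_s_mul_s b := by
    simpa only [ofFree_fe, ofFree_fu, ofFree_fs, map_mul, map_star, map_one] using
      ofFree_eq C (RingCStarRel.star_s_mul_s b)
  u_zero := by
    simpa only [ofFree_fe, ofFree_fu, ofFree_fs, map_one] using ofFree_eq C RingCStarRel.u_zero
  mul a c b d := by
    simpa only [ofFree_fe, ofFree_fu, ofFree_fs, map_mul] using
      ofFree_eq C (RingCStarRel.mul a c b d)

theorem e_univ : e C ⟨Set.univ, C.isSetAlgebra.univ_mem⟩ = 1 := by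
  simpa only [ofFree_fe, ofFree_fu, ofFree_fs, map_one] using
    ofFree_eq C RingCStarRel.e_univ

theorem e_union (X Y : C.sets) (h : Disjoint (X : Set R) (Y : Set R)) :
    e C ⟨X ∪ Y, C.isSetAlgebra.union_mem X.2 Y.2⟩ = e C X + e C Y := by
  simpa only [ofFree_fe, ofFree_fu, ofFree_fs, map_add] using
    ofFree_eq C (RingCStarRel.e_union X Y h)

theorem e_affineImage (a : R) (b : R⁰) (X : C.sets) :
    u C a * s C b * e C X * star (u C a * s C b) =
      e C ⟨affineImage a (b : R) X, C.affine_mem a b X X.2⟩ := by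
  simpa only [ofFree_fe, ofFree_fu, ofFree_fs, map_mul, map_star] using
    ofFree_eq C (RingCStarRel.ad a b X)

theorem e_empty : e C ⟨∅, C.isSetAlgebra.empty_mem⟩ = 0 := by
  have h := e_union C ⟨∅, C.isSetAlgebra.empty_mem⟩ ⟨∅, C.isSetAlgebra.empty_mem⟩ (by simp)
  simpa using h

/-- This is covariance applied to `X = R`, where `e_R = 1`. -/
theorem rangeProj_eq_e (a : R) (b : R⁰) : rangeProj (u C) (s C) a b =
    e C ⟨affineImage a (b : R) Set.univ, C.affine_mem a b _ C.isSetAlgebra.univ_mem⟩ := by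
  rw [← e_affineImage C a b ⟨Set.univ, C.isSetAlgebra.univ_mem⟩, e_univ, mul_one, rangeProj]

/-- Finite additivity, splitting off one residue class at a time. The case `X = R` is the sum
relation of `𝔄[R]`; general `X` shows that the `e_X` are determined by the `u^a` and `s_b`. -/
theorem sum_rangeProj_eq_e {c : R⁰} {S : Finset R} {X : Set R} (hS : IsTransversal (c : R) X S)
    (hX : X ∈ C.sets) : ∑ t ∈ S, rangeProj (u C) (s C) t c = e C ⟨X, hX⟩ := by
  classical
  induction S using Finset.induction_on generalizing X with
  | empty =>
    obtain rfl : X = ∅ := Set.eq_empty_iff_forall_notMem.2 fun x hx => by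
      simpa using (hS.mem_iff x).1 hx
    rw [Finset.sum_empty, e_empty]
  | insert t S ht ih =>
    have hmem : ∀ x, x ∈ affineImage t (c : R) Set.univ ↔ (c : R) ∣ x - t := fun x =>
      ⟨by rintro ⟨r, -, rfl⟩; simp, fun ⟨r, hr⟩ => ⟨r, trivial, by
        change t + c * r = x; linear_combination -hr⟩⟩
    have hY : affineImage t (c : R) Set.univ ∈ C.sets :=
      C.affine_mem t c _ C.isSetAlgebra.univ_mem
    -- Removing the class of `t` from `X` leaves exactly the classes of `S`, because `t` is
    -- congruent to no element of `S`.
    have hS' : IsTransversal (c : R) (X \ affineImage t (c : R) Set.univ) S :=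
      { mem_iff := fun x => by
          rw [Set.mem_sdiff, hmem, hS.mem_iff]
          simp only [Finset.exists_mem_insert]
          refine ⟨fun h => h.1.resolve_left h.2, fun h => ⟨.inr h, fun h2 => ?_⟩⟩
          obtain ⟨t', ht', h3⟩ := h
          refine ht ?_
          rwa [hS.eq_of_dvd t (by simp) t' (by simp [ht']) (by simpa using dvd_sub h3 h2)]
        eq_of_dvd := fun a ha b hb => hS.eq_of_dvd a (by simp [ha]) b (by simp [hb]) }
    rw [Finset.sum_insert ht, ih hS' (C.isSetAlgebra.sdiff_mem hX hY), rangeProj_eq_e,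
      ← e_union C ⟨_, hY⟩ ⟨_, C.isSetAlgebra.sdiff_mem hX hY⟩ Set.disjoint_sdiff_right]
    congr 2
    refine Set.union_sdiff_cancel fun x hx => ?_
    exact (hS.mem_iff x).2 ⟨t, by simp, (hmem x).1 hx⟩

end RingCStarAlgebra

/-! ### The two homomorphisms -/

section Homs

open CStarPresentation.UniversalCStarAlgebra IsAffineFamily

variable {R : Type u} [CommRing R]

theorem exists_cuntzLiToRingCStar (C : InvariantSetAlgebra R) :
    ∃ φ : CuntzLiAlgebra R →⋆ₐ[ℂ] RingCStarAlgebra C,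
      (∀ a : R, φ (CuntzLiAlgebra.u a) = RingCStarAlgebra.u C a) ∧
      (∀ b : R⁰, φ (CuntzLiAlgebra.s b) = RingCStarAlgebra.s C b) := by
  have hA := RingCStarAlgebra.isAffineFamily C
  let f : CuntzLiGen R → RingCStarAlgebra C
    | .u a => RingCStarAlgebra.u C a
    | .s b => RingCStarAlgebra.s C b
  have fu : ∀ a, FreeStarAlgebra.lift f (CuntzLi.fu a) = RingCStarAlgebra.u C a := fun a =>
    FreeStarAlgebra.lift_gen f (CuntzLiGen.u a)
  have fs : ∀ b, FreeStarAlgebra.lift f (CuntzLi.fs b) = RingCStarAlgebra.s C b := fun b =>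
    FreeStarAlgebra.lift_gen f (CuntzLiGen.s b)
  have key : ∀ x y, CuntzLiRel R x y → FreeStarAlgebra.lift f x = FreeStarAlgebra.lift f y := by
    intro x y h
    cases h with
    | star_u_mul_u a => simp only [map_mul, map_star, map_one, fu, hA.star_u_mul_u]
    | u_mul_star_u a => simp only [map_mul, map_star, map_one, fu, hA.u_mul_star_u]
    | star_s_mul_s b => simp only [map_mul, map_star, map_one, fs, hA.star_s_mul_s]
    | u_zero => simp only [map_one, fu, hA.u_zero]
    | mul a c b d => simp only [map_mul, fu, fs, hA.mul]
    | sum_eq_one b T hT =>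
      -- This is the only relation not shared by the two presentations.
      simp only [map_sum, map_mul, map_star, map_one, fu, fs, ← hA.rangeProj_eq]
      rw [RingCStarAlgebra.sum_rangeProj_eq_e C (.of_existsUnique hT) C.isSetAlgebra.univ_mem,
        RingCStarAlgebra.e_univ]
  obtain ⟨φ, hφ, -⟩ := existsUnique_lift (P := cuntzLiPresentation R) f key
  exact ⟨φ, fun a => hφ (.u a), fun b => hφ (.s b)⟩

variable [IsDomain R]

/-- Each relation involving the `e_X` is verified by writing the sets in terms of explicit
transversals, with a common modulus whenever two sets occur. -/
theorem exists_ringCStarToCuntzLi (hT : ∀ b : R⁰, ∃ T : Finset R, IsTransversal (b : R) Set.univ T)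
    (C : InvariantSetAlgebra R) (hC : ∀ X ∈ C.sets, ∃ c : R⁰, ∀ x ∈ X, ∀ r, x + c * r ∈ X) :
    ∃ χ : RingCStarAlgebra C →⋆ₐ[ℂ] CuntzLiAlgebra R,
      (∀ a : R, χ (RingCStarAlgebra.u C a) = CuntzLiAlgebra.u a) ∧
      (∀ b : R⁰, χ (RingCStarAlgebra.s C b) = CuntzLiAlgebra.s b) ∧
      (∀ X : C.sets, χ (RingCStarAlgebra.e C X) =
        setProj CuntzLiAlgebra.u CuntzLiAlgebra.s (X : Set R)) := by
  classical
  have hA := CuntzLiAlgebra.isAffineFamily (R := R)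
  have hE : ∀ {X : Set R} {c : R⁰} {S : Finset R}, IsTransversal (c : R) X S →
      setProj CuntzLiAlgebra.u CuntzLiAlgebra.s X =
        ∑ t ∈ S, rangeProj CuntzLiAlgebra.u CuntzLiAlgebra.s t c :=
    hA.setProj_eq hT CuntzLiAlgebra.sum_rangeProj
  have hinter : ∀ X Y : C.sets, setProj CuntzLiAlgebra.u CuntzLiAlgebra.s (X : Set R) *
      setProj CuntzLiAlgebra.u CuntzLiAlgebra.s (Y : Set R) =
        setProj CuntzLiAlgebra.u CuntzLiAlgebra.s ((X : Set R) ∩ Y) := fun X Y => by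
    obtain ⟨c, hc⟩ := hC X X.2
    obtain ⟨d, hd⟩ := hC Y Y.2
    -- The product of the periods is a period of both sets, so `X`, `Y` and `X ∩ Y` all select from
    -- one transversal `T` of `R`, whose range projections are orthogonal.
    obtain ⟨T, hT⟩ := hT (c * d)
    have hX' : ∀ x ∈ (X : Set R), ∀ r, x + (c * d : R⁰) * r ∈ (X : Set R) := fun x hx r => by
      simpa [mul_assoc] using hc x hx (d * r)
    have hY' : ∀ x ∈ (Y : Set R), ∀ r, x + (c * d : R⁰) * r ∈ (Y : Set R) := fun x hx r => by
      simpa [mul_assoc, mul_left_comm] using hd x hx (c * r)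
    rw [hE (hT.filter hX'), hE (hT.filter hY'),
      hE (hT.filter (X := (X : Set R) ∩ Y) fun x hx r => ⟨hX' x hx.1 r, hY' x hx.2 r⟩), Finset.sum_mul_sum]
    have horth : ∀ t ∈ T, ∀ t' ∈ T, rangeProj CuntzLiAlgebra.u CuntzLiAlgebra.s t (c * d) *
        rangeProj CuntzLiAlgebra.u CuntzLiAlgebra.s t' (c * d) =
          if t = t' then rangeProj CuntzLiAlgebra.u CuntzLiAlgebra.s t (c * d) else 0 :=
      fun t ht t' ht' => by
        split_ifs with h
        · rw [← h, hA.rangeProj_mul_self]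
        · exact mul_eq_zero_of_sum_projections_eq_one (fun i _ => star_rangeProj i _)
            (fun i _ => hA.rangeProj_mul_self i _) (CuntzLiAlgebra.sum_rangeProj _ T hT)
            ht' ht (Ne.symm h)
    rw [Finset.sum_congr rfl fun t ht => Finset.sum_congr rfl fun t' ht' =>
      horth t (Finset.mem_filter.1 ht).1 t' (Finset.mem_filter.1 ht').1]
    simp only [Finset.sum_ite_eq]
    rw [← Finset.sum_filter]
    refine Finset.sum_congr ?_ fun _ _ => rfl
    ext t
    simp only [Finset.mem_filter, Set.mem_inter_iff]
    tauto
  let f : RingCStarGen C → CuntzLiAlgebra R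
    | .e X => setProj CuntzLiAlgebra.u CuntzLiAlgebra.s (X : Set R)
    | .u a => CuntzLiAlgebra.u a
    | .s b => CuntzLiAlgebra.s b
  have fe : ∀ X, FreeStarAlgebra.lift f (RingCStar.fe X) =
      setProj CuntzLiAlgebra.u CuntzLiAlgebra.s (X : Set R) := fun X =>
    FreeStarAlgebra.lift_gen f (RingCStarGen.e X)
  have fu : ∀ a, FreeStarAlgebra.lift f (RingCStar.fu a) = CuntzLiAlgebra.u a := fun a =>
    FreeStarAlgebra.lift_gen f (RingCStarGen.u a)
  have fs : ∀ b, FreeStarAlgebra.lift f (RingCStar.fs b) = CuntzLiAlgebra.s b := fun b =>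
    FreeStarAlgebra.lift_gen f (RingCStarGen.s b)
  have key : ∀ x y, RingCStarRel C x y → FreeStarAlgebra.lift f x = FreeStarAlgebra.lift f y := by
    intro x y h
    cases h with
    | star_e X =>
      obtain ⟨c, hc⟩ := hC X X.2
      obtain ⟨T, hT⟩ := hT c
      rw [map_star, fe, hE (hT.filter hc), star_sum]
      exact Finset.sum_congr rfl fun t _ => star_rangeProj t c
    | e_mul_self X => rw [map_mul, fe, hinter, Set.inter_self]
    | star_u_mul_u a => simp only [map_mul, map_star, map_one, fu, hA.star_u_mul_u]
    | u_mul_star_u a => simp only [map_mul, map_star, map_one, fu, hA.u_mul_star_u]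
    | star_s_mul_s b => simp only [map_mul, map_star, map_one, fs, hA.star_s_mul_s]
    | u_zero => simp only [map_one, fu, hA.u_zero]
    | mul a c b d => simp only [map_mul, fu, fs, hA.mul]
    | ad a b X =>
      obtain ⟨c, hc⟩ := hC X X.2
      obtain ⟨T, hT⟩ := hT c
      have hb : (b : R) ≠ 0 := nonZeroDivisors.coe_ne_zero b
      have hX := hT.filter hc
      have hbX := hX.affineImage a hb
      rw [← Submonoid.coe_mul] at hbX
      -- The representatives `a + b * t` of `a + b X` modulo `b * c` are distinct, so both sides are
      -- sums over the same `t` and match termwise.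
      rw [map_mul, map_star, map_mul, map_mul, fe, fe, fu, fs, hE hX, hE hbX, Finset.mul_sum,
        Finset.sum_mul, Finset.sum_image fun t _ t' _ h => mul_left_cancel₀ hb (add_left_cancel h)]
      exact Finset.sum_congr rfl fun t _ => hA.conj_rangeProj a t b c
    | e_univ =>
      obtain ⟨T, hT⟩ := hT 1
      rw [fe, map_one, hE hT, CuntzLiAlgebra.sum_rangeProj 1 T hT]
    | e_inter X Y => rw [map_mul, fe, fe, fe, hinter]
    | e_union X Y h =>
      obtain ⟨c, hc⟩ := hC X X.2
      obtain ⟨d, hd⟩ := hC Y Y.2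
      obtain ⟨T, hT⟩ := hT (c * d)
      have hX := hT.filter (X := (X : Set R)) fun x hx r => by
        simpa [mul_assoc] using hc x hx (d * r)
      have hY := hT.filter (X := (Y : Set R)) fun x hx r => by
        simpa [mul_assoc, mul_left_comm] using hd x hx (c * r)
      rw [map_add, fe, fe, fe, hE hX, hE hY, hE (hX.union hY h), Finset.sum_union]
      exact Finset.disjoint_left.2 fun t ht ht' =>
        Set.disjoint_left.1 h (hX.mem ht) (hY.mem ht')
  obtain ⟨χ, hχ, -⟩ := existsUnique_lift (P := ringCStarPresentation C) f key
  exact ⟨χ, fun a => hχ (.u a), fun b => hχ (.s b), fun X => hχ (.e X)⟩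

end Homs

end

/-! ### The two homomorphisms are mutually inverse -/

open CStarPresentation.UniversalCStarAlgebra IsAffineFamily in
theorem mainTheorem6 {R : Type u} [CommRing R] [IsDomain R]
    (hfin : ∀ b : R, b ≠ 0 → Finite (R ⧸ Ideal.span {b}))
    (F : Set (Ideal R)) (hF : ∀ I ∈ F, I ≠ ⊥) :
    ∃ φ : CuntzLiAlgebra R →⋆ₐ[ℂ] RingCStarAlgebra (idealSetAlgebra F),
      (∀ a : R, φ (CuntzLiAlgebra.u a) = RingCStarAlgebra.u (idealSetAlgebra F) a) ∧
      (∀ b : R⁰, φ (CuntzLiAlgebra.s b) = RingCStarAlgebra.s (idealSetAlgebra F) b) ∧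
      (∀ ψ : CuntzLiAlgebra R →⋆ₐ[ℂ] RingCStarAlgebra (idealSetAlgebra F),
        (∀ a : R, ψ (CuntzLiAlgebra.u a) = RingCStarAlgebra.u (idealSetAlgebra F) a) →
        (∀ b : R⁰, ψ (CuntzLiAlgebra.s b) = RingCStarAlgebra.s (idealSetAlgebra F) b) →
        ψ = φ) ∧
      Function.Bijective φ := by
  have hT : ∀ b : R⁰, ∃ T : Finset R, IsTransversal (b : R) Set.univ T := fun b =>
    haveI := hfin b (nonZeroDivisors.coe_ne_zero b)
    IsTransversal.exists_univ (b : R)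
  have hC : ∀ X ∈ (idealSetAlgebra F).sets, ∃ c : R⁰, ∀ x ∈ X, ∀ r, x + c * r ∈ X :=
    fun X hX => exists_period_of_mem_idealSetAlgebra hF hX
  obtain ⟨φ, hφu, hφs⟩ := exists_cuntzLiToRingCStar (idealSetAlgebra F)
  obtain ⟨χ, hχu, hχs, hχe⟩ := exists_ringCStarToCuntzLi hT (idealSetAlgebra F) hC
  have hl : χ.comp φ = StarAlgHom.id ℂ _ := hom_ext fun g => by
    cases g with
    | u a => exact (congrArg χ (hφu a)).trans (hχu a)
    | s b => exact (congrArg χ (hφs b)).trans (hχs b)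
  have hr : φ.comp χ = StarAlgHom.id ℂ _ := hom_ext fun g => by
    cases g with
    | u a => exact (congrArg φ (hχu a)).trans (hφu a)
    | s b => exact (congrArg φ (hχs b)).trans (hφs b)
    -- The image of `e_X` in `𝔄[R]` is a sum of range projections, which `φ` carries to the same sum
    -- in the target; there it equals `e_X`.
    | e X =>
      obtain ⟨c, hc⟩ := hC X X.2
      obtain ⟨T, hT'⟩ := hT c
      have hX := hT'.filter hc
      refine (congrArg φ (hχe X)).trans ?_
      rw [CuntzLiAlgebra.isAffineFamily.setProj_eq hT CuntzLiAlgebra.sum_rangeProj hX, map_sum]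
      refine Eq.trans (Finset.sum_congr rfl fun t _ => ?_)
        (RingCStarAlgebra.sum_rangeProj_eq_e (idealSetAlgebra F) hX X.2)
      rw [rangeProj, rangeProj, map_mul, map_star, map_mul, hφu, hφs]
  refine ⟨φ, hφu, hφs, fun ψ hψu hψs => hom_ext fun g => ?_, ?_⟩
  · cases g with
    | u a => exact (hψu a).trans (hφu a).symm
    | s b => exact (hψs b).trans (hφs b).symm
  · exact Function.bijective_iff_has_inverse.2
      ⟨χ, fun x => DFunLike.congr_fun hl x, fun x => DFunLike.congr_fun hr x⟩
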